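/- For $n\ge 1$ let $P_n\subset\mathbb{R}^n$ be the permutohedron, the convex hull of the points $(\sigma^{-1}(1),\dots,\sigma^{-1}(n))$, $\sigma\in S_n$, and let $\Delta^k=v_1\cdots v_{k+1}$ be the standard $k$-simplex. Let $k\ge 2$, $m_1,\dots,m_k\ge 1$, $\epsilon>0$ and $I=[0,1]$. Put $$B=P_{m_1}\times\cdots\times P_{m_k}\times\Delta^k,\qquad G=P_{m_1}\times\cdots\times P_{m_k}\times\bigcup_{i=2}^{k}v_1\cdots\widehat{v_i}\cdots v_{k+1},$$ where $v_1\cdots\widehat{v_i}\cdots v_{k+1}$ is the facet of $\Delta^k$ opposite to $v_i$. Let $\partial B$ be the boundary of the convex polytope $B$ in its affine span (which has dimension $d=m_1+\cdots+m_k$), let $\mathrm{Int}(G)$ be the interior of $G$ in $\partial B$, and put $U=\partial B\setminus\mathrm{Int}(G)$. Let $E=\mathrm{Ext}_\epsilon(B)$ be the space obtained from the basic cell $B$ and the tab $G\times[0,\epsilon]$ by identifying $x\in G\subset B$ with $(x,0)$. Let $\partial E$ be the boundary of the $d$-dimensional topological manifold with boundary $E$, that is, the set of points of $E$ that have no open neighbourhood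 homeomorphic to an open subset of $\mathbb{R}^d$. Then there is a continuous map $H:E\times I\to E$ with $H(\cdot,0)=\mathrm{id}_E$ such that: 1. $H$ restricts to a deformation retraction of $B$ onto $U$: $H(B\times I)\subset B$, $H(B\times\{1\})=U$, and $H(x,t)=x$ for all $x\in U$, $t\in I$; 2. $H(\cdot,1)$ maps the tab $G\times[0,\epsilon]$ homeomorphically onto $E$; 3. $H(x,t)=x$ for all $x\in\partial E$, $t\in I$. -/

import Mathlib

/-- The vertex `v_σ = (σ⁻¹(1), …, σ⁻¹(n))` of the permutohedron. Indices and values in `Fin n` start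
at `0`, hence the `+ 1`. -/
def permVertex {n : ℕ} (σ : Equiv.Perm (Fin n)) : Fin n → ℝ :=
  fun i => ((σ⁻¹ i : Fin n) : ℕ) + 1

/-- The permutohedron `P_n ⊆ ℝⁿ`, the convex hull of the points `v_σ`, `σ ∈ S_n`. -/
def permutohedron (n : ℕ) : Set (Fin n → ℝ) :=
  convexHull ℝ (Set.range (permVertex (n := n)))

/-- The space `ℝ^{m_1} × ⋯ × ℝ^{m_k} × ℝ^{k+1}` that contains `P_{m_1} × ⋯ × P_{m_k} × Δ^k`. -/
abbrev CellSpace {k : ℕ} (m : Fin k → ℕ) : Type :=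
  ((i : Fin k) → (Fin (m i) → ℝ)) × (Fin (k + 1) → ℝ)

/-- The product `P_{m_1} × ⋯ × P_{m_k}`. -/
def permProduct {k : ℕ} (m : Fin k → ℕ) : Set ((i : Fin k) → (Fin (m i) → ℝ)) :=
  Set.univ.pi fun i => permutohedron (m i)

/-- The basic cell `P_{m_1} × ⋯ × P_{m_k} × Δ^k`. -/
def cell {k : ℕ} (m : Fin k → ℕ) : Set (CellSpace m) :=
  permProduct m ×ˢ stdSimplex ℝ (Fin (k + 1))

/-- The facet of `Δ^k` opposite to its vertex number `i` (numbered from `0`). -/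
def simplexFacet (k : ℕ) (i : Fin (k + 1)) : Set (Fin (k + 1) → ℝ) :=
  {x ∈ stdSimplex ℝ (Fin (k + 1)) | x i = 0}

/-- The glued part `P_{m_1} × ⋯ × P_{m_k} × ⋃_{i=2}^{k} v_1 ⋯ v̂_i ⋯ v_{k+1}` of the boundary of the
cell: the facets opposite to all the vertices except the first and the last one. -/
def gluedPart {k : ℕ} (m : Fin k → ℕ) : Set (CellSpace m) :=
  permProduct m ×ˢ ⋃ i ∈ {i : Fin (k + 1) | i ≠ 0 ∧ i ≠ Fin.last k}, simplexFacet k i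

/-- The boundary of the cell, that is, its frontier in its affine span
(a space of dimension `m_1 + ⋯ + m_k`). -/
def cellBoundary {k : ℕ} (m : Fin k → ℕ) : Set (CellSpace m) :=
  intrinsicFrontier ℝ (cell m)

/-- The interior of `A` relative to the subspace `Y`. -/
def interiorIn {X : Type*} [TopologicalSpace X] (Y A : Set X) : Set X :=
  (Subtype.val : Y → X) '' interior ((Subtype.val : Y → X) ⁻¹' A)

/-- The unglued part of the boundary of the cell: the boundary without the interior of the glued
part, the latter taken in the boundary. -/
def ungluedPart {k : ℕ} (m : Fin k → ℕ) : Set (CellSpace m) :=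
  cellBoundary m \ interiorIn (cellBoundary m) (gluedPart m)

/-- The extended cell `Ext_ε`: the union of the cell and of `gluedPart × [0, ε]` along
`gluedPart = gluedPart × {0}`. The cell is placed at height `0` of `CellSpace m × ℝ`, so that
the two pieces, both compact, meet exactly in `gluedPart × {0}`. -/
def extCell {k : ℕ} (m : Fin k → ℕ) (ε : ℝ) : Set (CellSpace m × ℝ) :=
  cell m ×ˢ {0} ∪ gluedPart m ×ˢ Set.Icc 0 ε

/-- The basic cell, as a subset of the extended cell. -/
def basicInExt {k : ℕ} (m : Fin k → ℕ) (ε : ℝ) : Set (extCell m ε) :=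
  {z | z.1 ∈ cell m ×ˢ ({0} : Set ℝ)}

/-- The unglued part of the boundary of the basic cell, as a subset of the extended cell. -/
def ungluedInExt {k : ℕ} (m : Fin k → ℕ) (ε : ℝ) : Set (extCell m ε) :=
  {z | z.1 ∈ ungluedPart m ×ˢ ({0} : Set ℝ)}

/-- The tab `gluedPart × [0, ε]`, as a subset of the extended cell. -/
def tabInExt {k : ℕ} (m : Fin k → ℕ) (ε : ℝ) : Set (extCell m ε) :=
  {z | z.1 ∈ gluedPart m ×ˢ Set.Icc (0 : ℝ) ε}

/-- The boundary of a topological manifold `X` of dimension `d` with boundary: the points that have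
no open neighbourhood homeomorphic to an open subset of `ℝ^d`. -/
def manifoldBoundary (d : ℕ) (X : Type*) [TopologicalSpace X] : Set X :=
  {x | ¬ ∃ e : OpenPartialHomeomorph X (EuclideanSpace ℝ (Fin d)), x ∈ e.source}

/-! The homotopy slides points along rays. In the affine span of the cell there is a point outside
the cell, (`q`, `viewPoint k`), from which exactly the glued facets are visible: its permutohedral
part is a relative interior point, its middle simplex coordinates are -1 and its two end coordinates
are positive. With this point as origin the cell is a truncated cone `1 ≤ lo`, `hi ≤ 1`. Here `lo`
is the minimum of the middle coordinates and `hi` is the gauge of the convex set cut out by the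
hidden facets. A ray meeting the cell enters it through the glued part and leaves it through the
unglued part; measured by `lo`, it runs over `[1, top]` inside the cell (`cell_eq_image`,
`gluedPart_eq_image`, `ungluedPart_eq_image`).

Attaching the tab amounts to lengthening each of these segments by `ε`, to `[1, top + ε]`. The map
`fold` identifies this lengthened cone with the extended cell: the piece `[1, 1 + ε]` becomes the
tab and the rest becomes the cell (`isEmbedding_fold`, `range_fold`). On every ray the homotopy
moves linearly from the identity to the map that stretches `[1, 1 + ε]` affinely onto `[1, top + ε]`
and sends the rest to the end point. So the tab covers everything and the cell collapses onto the
unglued part.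

A point that moves satisfies `1 < lo`, `1 < top` and `lo < top + ε`, hence is interior to the
lengthened cone and has a Euclidean neighbourhood. Thus manifold boundary points stay fixed, and the
boundary need not be computed (`exists_homotopy`). -/

/-! ### Truncated cones and their rays. -/

/-- Two continuous positively homogeneous functions on a real vector space. The rays on which `lo` is
positive enter the truncated cone `{v | 1 ≤ lo v ∧ hi v ≤ 1}` where `lo = 1` and leave it
where `hi = 1`. -/
structure RadialPair (V : Type*) [NormedAddCommGroup V] [NormedSpace ℝ V] where
  lo : V → ℝ
  hi : V → ℝ
  continuous_lo : Continuous lo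
  continuous_hi : Continuous hi
  lo_smul : ∀ (t : ℝ) (v : V), 0 < t → lo (t • v) = t * lo v
  hi_smul : ∀ (t : ℝ) (v : V), 0 < t → hi (t • v) = t * hi v
  hi_pos : ∀ v, 0 < lo v → 0 < hi v

namespace RadialPair

variable {V : Type*} [NormedAddCommGroup V] [NormedSpace ℝ V] (R : RadialPair V)

/-- The truncated cone cut out by the two functions. -/
def cone : Set V := {v | 1 ≤ R.lo v ∧ R.hi v ≤ 1}

/-- The part of the truncated cone through which the rays enter. -/
def entry : Set V := {v | R.lo v = 1 ∧ R.hi v ≤ 1}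

/-- The part of the truncated cone through which the rays leave. -/
def exit : Set V := {v | 1 ≤ R.lo v ∧ R.hi v = 1}

/-- The value of `lo` at the point where the ray of `v` leaves the truncated cone. -/
noncomputable def top (v : V) : ℝ := R.lo v / R.hi v

/-- The point on the ray of `v` at which `lo` takes the value `a`. -/
noncomputable def rescale (a : ℝ) (v : V) : V := (a / R.lo v) • v

/-- The truncated cone lengthened by `ε` along every ray. -/
def body (ε : ℝ) : Set V := {v | 1 ≤ R.lo v ∧ 1 ≤ R.top v ∧ R.lo v ≤ R.top v + ε}

variable {R} {ε : ℝ}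

theorem lo_rescale {a : ℝ} {v : V} (ha : 0 < a) (hv : 0 < R.lo v) :
    R.lo (R.rescale a v) = a := by
  rw [rescale, R.lo_smul _ _ (div_pos ha hv), div_mul_cancel₀ _ hv.ne']

theorem top_rescale {a : ℝ} {v : V} (ha : 0 < a) (hv : 0 < R.lo v) :
    R.top (R.rescale a v) = R.top v := by
  have h := div_pos ha hv
  rw [top, rescale, R.lo_smul _ _ h, R.hi_smul _ _ h, mul_div_mul_left _ _ h.ne', top]

theorem rescale_rescale {a b : ℝ} {v : V} (ha : 0 < a) (hv : 0 < R.lo v) :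
    R.rescale b (R.rescale a v) = R.rescale b v := by
  rw [rescale, lo_rescale ha hv, rescale, rescale, smul_smul, div_mul_div_cancel₀ ha.ne']

theorem rescale_lo {v : V} (hv : 0 < R.lo v) : R.rescale (R.lo v) v = v := by
  rw [rescale, div_self hv.ne', one_smul]

theorem hi_le_one_iff {v : V} (hv : 0 < R.lo v) : R.hi v ≤ 1 ↔ R.lo v ≤ R.top v := by
  rw [top, le_div_iff₀ (R.hi_pos v hv), mul_le_iff_le_one_right hv]

theorem hi_eq_one_iff {v : V} (hv : 0 < R.lo v) : R.hi v = 1 ↔ R.lo v = R.top v := by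
  rw [top, eq_div_iff (R.hi_pos v hv).ne', mul_eq_left₀ hv.ne']

theorem lo_pos (w : R.body ε) : 0 < R.lo w := one_pos.trans_le w.2.1

theorem continuous_lo_body : Continuous fun w : R.body ε => R.lo w :=
  R.continuous_lo.comp continuous_subtype_val

theorem continuous_top_body : Continuous fun w : R.body ε => R.top w :=
  continuous_lo_body.div (R.continuous_hi.comp continuous_subtype_val)
    fun w => (R.hi_pos _ (lo_pos w)).ne'

theorem rescale_mem_body {a : ℝ} {v : V} (hv : 0 < R.lo v) (h1 : 1 ≤ a) (ht : 1 ≤ R.top v)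
    (ha : a ≤ R.top v + ε) : R.rescale a v ∈ R.body ε := by
  have h0 : 0 < a := one_pos.trans_le h1
  refine ⟨?_, ?_, ?_⟩
  · rwa [lo_rescale h0 hv]
  · rwa [top_rescale h0 hv]
  · rwa [lo_rescale h0 hv, top_rescale h0 hv]

/-! ### Folding the lengthened cone into cone plus cylinder. -/

variable (R ε) in
/-- The map that folds the lengthened cone: the first segment of length `ε` of every ray becomes
vertical, and the rest slides down onto the truncated cone. -/
noncomputable def fold (w : R.body ε) : V × ℝ :=
  (R.rescale (max (R.lo w - ε) 1) (w : V), max (1 + ε - R.lo w) 0)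

theorem continuous_fold : Continuous (R.fold ε) := by
  have h := continuous_lo_body (R := R) (ε := ε)
  refine Continuous.prodMk (Continuous.smul (Continuous.div ?_ h fun w => (lo_pos w).ne')
    continuous_subtype_val) ?_
  · exact (h.sub continuous_const).max continuous_const
  · exact (continuous_const.sub h).max continuous_const

theorem fold_of_le {w : R.body ε} (h : R.lo w ≤ 1 + ε) :
    R.fold ε w = (R.rescale 1 (w : V), 1 + ε - R.lo w) := by
  rw [fold, max_eq_right (by linarith), max_eq_left (by linarith)]

theorem fold_of_ge {w : R.body ε} (h : 1 + ε ≤ R.lo w) :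
    R.fold ε w = (R.rescale (R.lo w - ε) (w : V), 0) := by
  rw [fold, max_eq_left (by linarith), max_eq_right (by linarith)]

theorem isEmbedding_fold : Topology.IsEmbedding (R.fold ε) := by
  -- A continuous left inverse: subtracting the height and adding `ε` recovers the original value of
  -- `lo`. The maximum in the denominator makes `g` continuous everywhere and changes nothing on the
  -- image, where `lo ≥ 1`.
  let g : V × ℝ → V := fun p => ((R.lo p.1 - p.2 + ε) / max (R.lo p.1) 1) • p.1
  have hl : Continuous fun p : V × ℝ => R.lo p.1 := R.continuous_lo.comp continuous_fst
  have hg : Continuous g := by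
    refine Continuous.smul (Continuous.div ?_ (hl.max continuous_const) fun p => ?_) continuous_fst
    · exact (hl.sub continuous_snd).add continuous_const
    · exact (one_pos.trans_le (le_max_right _ _)).ne'
  refine Topology.IsEmbedding.of_comp continuous_fold hg ?_
  convert Topology.IsEmbedding.subtypeVal using 1
  funext w
  have hw := lo_pos w
  have ha : (1 : ℝ) ≤ max (R.lo w - ε) 1 := le_max_right _ _
  have hs : max (R.lo w - ε) 1 - max (1 + ε - R.lo w) 0 + ε = R.lo w := by
    rcases le_total (R.lo w) (1 + ε) with h | h
    · rw [max_eq_right (by linarith), max_eq_left (by linarith)]; ring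
    · rw [max_eq_left (by linarith), max_eq_right (by linarith)]; ring
  have h0 : (0 : ℝ) < max (R.lo w - ε) 1 := one_pos.trans_le ha
  simp only [Function.comp, g, fold]
  rw [lo_rescale h0 hw, hs, max_eq_left ha]
  have := rescale_rescale (R := R) (b := R.lo w) h0 hw
  rw [rescale_lo hw, rescale, lo_rescale h0 hw] at this
  exact this

theorem fold_mem_cone_iff (w : R.body ε) :
    R.fold ε w ∈ R.cone ×ˢ ({0} : Set ℝ) ↔ 1 + ε ≤ R.lo w := by
  constructor
  · rintro ⟨-, h⟩
    by_contra hlt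
    rw [fold_of_le (not_le.1 hlt).le] at h
    simp only [Set.mem_singleton_iff] at h
    linarith
  · intro h
    rw [fold_of_ge h]
    have h0 : 0 < R.lo w - ε := by linarith
    have hl := lo_rescale (R := R) h0 (lo_pos w)
    refine ⟨⟨?_, ?_⟩, rfl⟩
    · simp only [hl]; linarith
    · simp only
      rw [hi_le_one_iff (by rw [hl]; exact h0), hl, top_rescale h0 (lo_pos w)]
      linarith [w.2.2.2]

theorem fold_mem_exit_iff (w : R.body ε) :
    R.fold ε w ∈ R.exit ×ˢ ({0} : Set ℝ) ↔ R.lo w = R.top w + ε := by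
  have key (h : 1 + ε ≤ R.lo w) :
      R.fold ε w ∈ R.exit ×ˢ ({0} : Set ℝ) ↔ R.lo w = R.top w + ε := by
    rw [fold_of_ge h]
    have h0 : 0 < R.lo w - ε := by linarith
    have hl := lo_rescale (R := R) h0 (lo_pos w)
    simp only [exit, Set.mem_prod, Set.mem_ofPred_eq, Set.mem_singleton_iff, and_true]
    rw [hi_eq_one_iff (by rw [hl]; exact h0), hl, top_rescale h0 (lo_pos w)]
    constructor
    · rintro ⟨-, h⟩; linarith
    · intro h; constructor <;> linarith
  constructor
  · intro h
    exact (key ((fold_mem_cone_iff w).1 ⟨⟨h.1.1, h.1.2.le⟩, h.2⟩)).1 h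
  · intro h
    exact (key (by linarith [w.2.2.1])).2 h

theorem fold_mem_entry_iff (w : R.body ε) :
    R.fold ε w ∈ R.entry ×ˢ Set.Icc 0 ε ↔ R.lo w ≤ 1 + ε := by
  constructor
  · rintro ⟨⟨h, -⟩, -⟩
    by_contra hlt
    have hlt := not_le.1 hlt
    rw [fold_of_ge hlt.le] at h
    simp only at h
    rw [lo_rescale (by linarith [lo_pos w]) (lo_pos w)] at h
    linarith
  · intro h
    rw [fold_of_le h]
    have hl := lo_rescale (R := R) one_pos (lo_pos w)
    refine ⟨⟨hl, ?_⟩, ?_, ?_⟩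
    · simp only
      rw [hi_le_one_iff (by rw [hl]; exact one_pos), hl, top_rescale one_pos (lo_pos w)]
      exact w.2.2.1
    · simp only; linarith
    · simp only; linarith [w.2.1]

theorem range_fold (hε : 0 < ε) :
    Set.range (R.fold ε) = R.cone ×ˢ {0} ∪ R.entry ×ˢ Set.Icc 0 ε := by
  ext ⟨v, s⟩
  constructor
  · rintro ⟨w, hw⟩
    rw [← hw]
    rcases le_total (R.lo w) (1 + ε) with h | h
    · exact Or.inr ((fold_mem_entry_iff w).2 h)
    · exact Or.inl ((fold_mem_cone_iff w).2 h)
  · rintro (⟨⟨h1, h2⟩, h3⟩ | ⟨⟨h1, h2⟩, h3, h4⟩)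
    · simp only [Set.mem_singleton_iff] at h1 h2 h3
      have hv : 0 < R.lo v := by linarith
      rw [hi_le_one_iff hv] at h2
      have ha : 0 < R.lo v + ε := by linarith
      have hl := lo_rescale (R := R) ha hv
      refine ⟨⟨R.rescale (R.lo v + ε) v, rescale_mem_body hv ?_ ?_ ?_⟩, ?_⟩
      · linarith
      · linarith
      · linarith
      · rw [fold_of_ge (by simp only [hl]; linarith)]
        simp only [hl, rescale_rescale ha hv, add_sub_cancel_right, rescale_lo hv, h3]
    · simp only at h1 h2 h3 h4
      have hv : 0 < R.lo v := by linarith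
      rw [hi_le_one_iff hv, h1] at h2
      have ha : 0 < 1 + ε - s := by linarith
      have hl := lo_rescale (R := R) ha hv
      refine ⟨⟨R.rescale (1 + ε - s) v, rescale_mem_body hv ?_ ?_ ?_⟩, ?_⟩
      · linarith
      · linarith
      · linarith
      · rw [fold_of_le (by simp only [hl]; linarith)]
        have hr := rescale_lo hv
        rw [h1] at hr
        simp only [hl, rescale_rescale ha hv, hr]
        congr 1; ring

/-! ### The deformation along the rays. -/

variable (R ε) in
/-- The end of the deformation, read off on the values of `lo`: the first segment of length `ε` of
a ray is stretched over the whole ray. -/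
noncomputable def stretch (w : V) : ℝ :=
  min (1 + (R.lo w - 1) * ((ε + R.top w - 1) / ε)) (R.top w + ε)

/-- The slope of the stretching is at least 1 because `1 ≤ top`, so points only move outwards. -/
theorem lo_le_stretch (hε : 0 < ε) (w : R.body ε) : R.lo w ≤ R.stretch ε w := by
  refine le_min ?_ w.2.2.2
  have h1 : 1 ≤ (ε + R.top w - 1) / ε := by
    rw [le_div_iff₀ hε]; linarith [w.2.2.1]
  nlinarith [w.2.1]

theorem stretch_le_top (w : V) : R.stretch ε w ≤ R.top w + ε := min_le_right _ _

theorem stretch_of_ge (hε : 0 < ε) {w : R.body ε} (h : 1 + ε ≤ R.lo w) :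
    R.stretch ε w = R.top w + ε := by
  refine min_eq_right ?_
  rw [mul_div_assoc', ← sub_le_iff_le_add', le_div_iff₀ hε]
  nlinarith [w.2.2.1]

theorem stretch_of_le (hε : 0 < ε) {w : R.body ε} (h : R.lo w ≤ 1 + ε) :
    R.stretch ε w = 1 + (R.lo w - 1) * ((ε + R.top w - 1) / ε) := by
  refine min_eq_left ?_
  rw [mul_div_assoc', ← le_sub_iff_add_le', div_le_iff₀ hε]
  nlinarith [w.2.2.1]

theorem continuous_stretch : Continuous fun w : R.body ε => R.stretch ε w := by
  refine Continuous.min ?_ (continuous_top_body.add continuous_const)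
  exact continuous_const.add ((continuous_lo_body.sub continuous_const).mul
    (((continuous_const.add continuous_top_body).sub continuous_const).div_const _))

variable (R ε) in
/-- The values of `lo` along the deformation. -/
noncomputable def level (t : unitInterval) (w : V) : ℝ :=
  R.lo w + t * (R.stretch ε w - R.lo w)

theorem lo_le_level (hε : 0 < ε) (t : unitInterval) (w : R.body ε) :
    R.lo w ≤ R.level ε t w := by
  have := mul_nonneg t.2.1 (sub_nonneg.2 (lo_le_stretch hε w))
  rw [level]; linarith

theorem level_le_top (hε : 0 < ε) (t : unitInterval) (w : R.body ε) :
    R.level ε t w ≤ R.top w + ε := by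
  have := mul_le_of_le_one_left (sub_nonneg.2 (lo_le_stretch hε w)) t.2.2
  have := stretch_le_top (R := R) (ε := ε) w
  rw [level]; linarith

theorem level_pos (hε : 0 < ε) (t : unitInterval) (w : R.body ε) : 0 < R.level ε t w :=
  (lo_pos w).trans_le (lo_le_level hε t w)

variable (R) in
/-- The deformation of the lengthened cone along its rays. -/
noncomputable def deform (hε : 0 < ε) (t : unitInterval) (w : R.body ε) : R.body ε :=
  ⟨R.rescale (R.level ε t w) w, rescale_mem_body (lo_pos w) (w.2.1.trans (lo_le_level hε t w))
    w.2.2.1 (level_le_top hε t w)⟩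

theorem continuous_deform (hε : 0 < ε) :
    Continuous fun p : unitInterval × R.body ε => R.deform hε p.1 p.2 := by
  have hl : Continuous fun p : unitInterval × R.body ε => R.lo p.2 :=
    continuous_lo_body.comp continuous_snd
  refine Continuous.subtype_mk (Continuous.smul (Continuous.div ?_ hl fun p => (lo_pos p.2).ne')
    (continuous_subtype_val.comp continuous_snd)) _
  exact hl.add ((continuous_subtype_val.comp continuous_fst).mul
    ((continuous_stretch.comp continuous_snd).sub hl))

theorem lo_deform (hε : 0 < ε) (t : unitInterval) (w : R.body ε) :
    R.lo (R.deform hε t w) = R.level ε t w :=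
  lo_rescale (level_pos hε t w) (lo_pos w)

theorem top_deform (hε : 0 < ε) (t : unitInterval) (w : R.body ε) :
    R.top (R.deform hε t w) = R.top w :=
  top_rescale (level_pos hε t w) (lo_pos w)

theorem deform_eq_self (hε : 0 < ε) {t : unitInterval} {w : R.body ε}
    (h : R.level ε t w = R.lo w) : R.deform hε t w = w := by
  refine Subtype.ext ?_
  rw [deform]
  simp only [h]
  exact rescale_lo (lo_pos w)

theorem deform_zero (hε : 0 < ε) (w : R.body ε) : R.deform hε 0 w = w :=
  deform_eq_self hε (by simp [level])

theorem deform_of_stretch_eq (hε : 0 < ε) {t : unitInterval} {w : R.body ε}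
    (h : R.stretch ε w = R.lo w) : R.deform hε t w = w :=
  deform_eq_self hε (by simp [level, h])

theorem deform_of_lo_eq_top (hε : 0 < ε) {t : unitInterval} {w : R.body ε}
    (h : R.lo w = R.top w + ε) : R.deform hε t w = w :=
  deform_of_stretch_eq hε
    (le_antisymm ((stretch_le_top _).trans_eq h.symm) (lo_le_stretch hε w))

theorem level_one (w : V) : R.level ε 1 w = R.stretch ε w := by simp [level]

/-- Points outside the open set `{1 < lo, 1 < top, lo < top + ε}` do not move. -/
theorem mem_of_deform_ne (hε : 0 < ε) {t : unitInterval} {w : R.body ε}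
    (h : R.deform hε t w ≠ w) : 1 < R.lo w ∧ 1 < R.top w ∧ R.lo w < R.top w + ε := by
  refine ⟨lt_of_le_of_ne w.2.1 fun h1 => h ?_, lt_of_le_of_ne w.2.2.1 fun h1 => h ?_,
    lt_of_le_of_ne w.2.2.2 fun h1 => h (deform_of_lo_eq_top hε h1)⟩
  · refine deform_of_stretch_eq hε ?_
    rw [stretch_of_le hε (by linarith), ← h1]; ring
  -- When `top = 1` the whole lengthened segment is `[1, 1 + ε]`, so the slope of the stretching is
  -- 1.
  · refine deform_of_stretch_eq hε ?_
    rw [stretch_of_le hε (by linarith [w.2.2.2]), ← h1, add_sub_cancel_right, div_self hε.ne']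
    ring

/-! ### The inverse of the final map on the tab. -/

variable (R ε) in
/-- The value of `lo` at the preimage of `w` under the end of the deformation. -/
noncomputable def shrink (w : V) : ℝ := 1 + (R.lo w - 1) * (ε / (ε + R.top w - 1))

theorem one_le_shrink (hε : 0 < ε) (w : R.body ε) : 1 ≤ R.shrink ε w := by
  have : 0 < ε + R.top w - 1 := by linarith [w.2.2.1]
  have := mul_nonneg (sub_nonneg.2 w.2.1) (div_pos hε this).le
  rw [shrink]; linarith

theorem shrink_le (hε : 0 < ε) (w : R.body ε) : R.shrink ε w ≤ 1 + ε := by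
  have h : 0 < ε + R.top w - 1 := by linarith [w.2.2.1]
  rw [shrink, add_le_add_iff_left, mul_div_assoc', div_le_iff₀ h]
  nlinarith [w.2.2.2]

theorem continuous_shrink (hε : 0 < ε) : Continuous fun w : R.body ε => R.shrink ε w := by
  refine continuous_const.add ((continuous_lo_body.sub continuous_const).mul
    (continuous_const.div ((continuous_const.add continuous_top_body).sub continuous_const) ?_))
  intro w
  have : 0 < ε + R.top w - 1 := by linarith [w.2.2.1]
  exact this.ne'

variable (R) in
/-- The inverse of the end of the deformation on the first segments of length `ε`. -/
noncomputable def undeform (hε : 0 < ε) (w : R.body ε) : R.body ε :=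
  ⟨R.rescale (R.shrink ε w) w, rescale_mem_body (lo_pos w) (one_le_shrink hε w) w.2.2.1
    (by linarith [shrink_le hε w, w.2.2.1])⟩

theorem shrink_pos (hε : 0 < ε) (w : R.body ε) : 0 < R.shrink ε w :=
  one_pos.trans_le (one_le_shrink hε w)

theorem lo_undeform (hε : 0 < ε) (w : R.body ε) : R.lo (R.undeform hε w) = R.shrink ε w :=
  lo_rescale (shrink_pos hε w) (lo_pos w)

theorem top_undeform (hε : 0 < ε) (w : R.body ε) : R.top (R.undeform hε w) = R.top w :=
  top_rescale (shrink_pos hε w) (lo_pos w)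

theorem continuous_undeform (hε : 0 < ε) : Continuous (R.undeform hε) :=
  Continuous.subtype_mk (Continuous.smul ((continuous_shrink hε).div continuous_lo_body
    fun w => (lo_pos w).ne') continuous_subtype_val) _

theorem deform_undeform (hε : 0 < ε) (w : R.body ε) :
    R.deform hε 1 (R.undeform hε w) = w := by
  refine Subtype.ext ?_
  have h : 0 < ε + R.top w - 1 := by linarith [w.2.2.1]
  have hl : R.level ε 1 (R.undeform hε w) = R.lo w := by
    rw [level_one, stretch_of_le hε (by rw [lo_undeform]; exact shrink_le hε w), lo_undeform,
      top_undeform, shrink]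
    field_simp
    ring
  rw [deform]
  simp only [hl]
  rw [undeform, rescale_rescale (shrink_pos hε w) (lo_pos w), rescale_lo (lo_pos w)]

theorem undeform_deform (hε : 0 < ε) {w : R.body ε} (hw : R.lo w ≤ 1 + ε) :
    R.undeform hε (R.deform hε 1 w) = w := by
  refine Subtype.ext ?_
  have h : 0 < ε + R.top w - 1 := by linarith [w.2.2.1]
  have hl : R.shrink ε (R.deform hε 1 w) = R.lo w := by
    rw [shrink, lo_deform, top_deform, level_one, stretch_of_le hε hw]
    field_simp
    ring
  rw [undeform]
  simp only [hl]
  rw [deform, rescale_rescale (level_pos hε 1 w) (lo_pos w), rescale_lo (lo_pos w)]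

end RadialPair

/-! ### Relative interiors, frontiers and Euclidean charts. -/

theorem mem_interiorIn_iff {X : Type*} [TopologicalSpace X] {Y A : Set X} {x : X} :
    x ∈ interiorIn Y A ↔ x ∈ Y ∧ A ∈ nhdsWithin x Y := by
  constructor
  · rintro ⟨y, hy, rfl⟩
    refine ⟨y.2, ?_⟩
    rw [mem_interior_iff_mem_nhds] at hy
    exact preimage_coe_mem_nhds_subtype.1 hy
  · rintro ⟨hx, hA⟩
    exact ⟨⟨x, hx⟩, mem_interior_iff_mem_nhds.2 (preimage_coe_mem_nhds_subtype.2 hA), rfl⟩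

theorem interiorIn_image {X Z : Type*} [TopologicalSpace X] [TopologicalSpace Z] {f : X → Z}
    (hf : Topology.IsEmbedding f) (Y A : Set X) :
    interiorIn (f '' Y) (f '' A) = f '' interiorIn Y A := by
  have key (x : X) : f '' A ∈ nhdsWithin (f x) (f '' Y) ↔ A ∈ nhdsWithin x Y := by
    rw [← hf.map_nhdsWithin_eq, Filter.mem_map, Set.preimage_image_eq _ hf.injective]
  ext z
  constructor
  · intro hz
    obtain ⟨⟨x, hx, rfl⟩, h⟩ := mem_interiorIn_iff.1 hz
    exact ⟨x, mem_interiorIn_iff.2 ⟨hx, (key x).1 h⟩, rfl⟩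
  · rintro ⟨x, hx, rfl⟩
    rw [mem_interiorIn_iff] at hx ⊢
    exact ⟨⟨x, hx.1, rfl⟩, (key x).2 hx.2⟩

/-- A set with nonempty interior spans the whole space affinely. -/
theorem intrinsicFrontier_eq_frontier {V : Type*} [NormedAddCommGroup V] [NormedSpace ℝ V]
    {s : Set V} (hs : (interior s).Nonempty) : intrinsicFrontier ℝ s = frontier s := by
  have h : affineSpan ℝ s = ⊤ := affineSpan_eq_top_of_nonempty_interior
    (hs.mono (interior_mono (subset_convexHull ℝ s)))
  have ho : IsOpen (affineSpan ℝ s : Set V) := by rw [h]; exact isOpen_univ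
  have hf := ho.isOpenMap_subtype_val.preimage_frontier_eq_frontier_preimage
    continuous_subtype_val s
  refine (congrArg _ hf.symm).trans (Set.image_preimage_eq_of_subset ?_)
  rw [Subtype.range_coe, h]
  exact Set.subset_univ _

theorem exists_openPartialHomeomorph_of_mem_interior {V : Type*} [TopologicalSpace V] {S : Set V}
    {w : S} (hw : (w : V) ∈ interior S) :
    ∃ e : OpenPartialHomeomorph S V, w ∈ e.source := by
  have hi : Topology.IsOpenEmbedding (Set.inclusion (interior_subset (s := S))) := by
    refine ⟨Topology.IsEmbedding.inclusion _, ?_⟩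
    rw [Set.range_inclusion]
    exact isOpen_interior.preimage continuous_subtype_val
  have : Nonempty (interior S) := ⟨⟨w, hw⟩⟩
  refine ⟨hi.toOpenPartialHomeomorph.symm.trans
    (isOpen_interior.isOpenEmbedding_subtypeVal).toOpenPartialHomeomorph, ?_⟩
  simp only [OpenPartialHomeomorph.trans_source, OpenPartialHomeomorph.symm_source,
    Topology.IsOpenEmbedding.toOpenPartialHomeomorph_target, Set.range_inclusion,
    Topology.IsOpenEmbedding.toOpenPartialHomeomorph_source, Set.preimage_univ, Set.inter_univ]
  exact hw

/-! ### The boundary of the truncated cone and the homotopy. -/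

namespace RadialPair

variable {V : Type*} [NormedAddCommGroup V] [NormedSpace ℝ V] {R : RadialPair V} {ε : ℝ}

theorem isClosed_cone : IsClosed R.cone :=
  (isClosed_le continuous_const R.continuous_lo).inter
    (isClosed_le R.continuous_hi continuous_const)

/-- An interior point stays in the cone under scaling by factors slightly below and slightly above
1; by homogeneity this makes both inequalities strict. -/
theorem interior_cone : interior R.cone = {v | 1 < R.lo v ∧ R.hi v < 1} := by
  apply subset_antisymm
  · intro v hv
    have hv' := interior_subset hv
    have h0 : 0 < R.lo v := one_pos.trans_le hv'.1
    have hc : ContinuousAt (fun t : ℝ => t • v) 1 := by fun_prop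
    have he : ∀ᶠ t : ℝ in nhds 1, t • v ∈ R.cone ∧ 0 < t :=
      (hc.eventually_mem (by simpa using mem_interior_iff_mem_nhds.1 hv)).and
        (lt_mem_nhds one_pos)
    obtain ⟨δ, hδ, hball⟩ := Metric.eventually_nhds_iff.1 he
    obtain ⟨⟨h1, -⟩, h1'⟩ := hball (y := 1 - δ / 2) (by
      rw [Real.dist_eq, abs_lt]; constructor <;> linarith)
    obtain ⟨⟨-, h2⟩, h2'⟩ := hball (y := 1 + δ / 2) (by
      rw [Real.dist_eq, abs_lt]; constructor <;> linarith)
    rw [R.lo_smul _ _ h1'] at h1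
    rw [R.hi_smul _ _ h2'] at h2
    have := mul_pos hδ h0
    have := mul_pos hδ (R.hi_pos v h0)
    constructor <;> linarith
  · refine interior_maximal (fun v hv => ⟨hv.1.le, hv.2.le⟩) ?_
    exact (isOpen_lt continuous_const R.continuous_lo).inter
      (isOpen_lt R.continuous_hi continuous_const)

theorem interior_cone_nonempty {u : V} (h0 : 0 < R.lo u) (hu : R.hi u < R.lo u) :
    (interior R.cone).Nonempty := by
  have hs : 0 < R.lo u + R.hi u := add_pos h0 (R.hi_pos u h0)
  have ht : 0 < 2 / (R.lo u + R.hi u) := div_pos two_pos hs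
  rw [interior_cone]
  refine ⟨(2 / (R.lo u + R.hi u)) • u, ?_, ?_⟩
  · rw [R.lo_smul _ _ ht, div_mul_eq_mul_div, one_lt_div hs]
    linarith
  · rw [R.hi_smul _ _ ht, div_mul_eq_mul_div, div_lt_one hs]
    linarith

theorem frontier_cone : frontier R.cone = R.entry ∪ R.exit := by
  rw [isClosed_cone.frontier_eq, interior_cone]
  ext v
  simp only [cone, entry, exit, Set.mem_sdiff, Set.mem_union, Set.mem_ofPred_eq]
  constructor
  · rintro ⟨⟨h1, h2⟩, h3⟩
    rcases h1.eq_or_lt with h | h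
    · exact Or.inl ⟨h.symm, h2⟩
    · exact Or.inr ⟨h1, le_antisymm h2 (not_lt.1 fun h4 => h3 ⟨h, h4⟩)⟩
  · rintro (⟨h1, h2⟩ | ⟨h1, h2⟩)
    · exact ⟨⟨h1.ge, h2⟩, fun h => h.1.ne' h1⟩
    · exact ⟨⟨h1, h2.le⟩, fun h => h.2.ne h2⟩

/-- A point of `entry` on the rim `hi = 1` is a limit of points of `exit` that are not in
`entry`. -/
theorem interiorIn_entry (hlo : ∀ v w, R.lo v + R.lo w ≤ R.lo (v + w))
    (hhi : ∀ v w, R.hi (v + w) ≤ R.hi v + R.hi w) {u : V} (hu : R.hi u < R.lo u) :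
    interiorIn (R.entry ∪ R.exit) R.entry = {v | R.lo v = 1 ∧ R.hi v < 1} := by
  ext v
  rw [mem_interiorIn_iff]
  constructor
  · rintro ⟨hv, hn⟩
    have hve : v ∈ R.entry := mem_of_mem_nhdsWithin hv hn
    refine ⟨hve.1, lt_of_le_of_ne hve.2 fun h1 => ?_⟩
    -- Push the rim point towards `u`, then scale back to `hi = 1`.
    let p : ℝ → V := fun t => (R.hi (v + t • u))⁻¹ • (v + t • u)
    have hline : Continuous fun t : ℝ => v + t • u := by fun_prop
    have hp : ContinuousAt p 0 := by
      refine ContinuousAt.smul (ContinuousAt.inv₀ ?_ ?_) hline.continuousAt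
      · exact (R.continuous_hi.comp hline).continuousAt
      · simp [h1]
    have hp0 : p 0 = v := by simp [p, h1]
    have hpos : ∀ᶠ t : ℝ in nhds 0, 0 < R.hi (v + t • u) :=
      (R.continuous_hi.comp hline).continuousAt.eventually_const_lt (by simp [h1])
    -- At the rim `lo = hi = 1`; superadditivity of `lo` and subadditivity of `hi` turn `hi u < lo
    -- u` into a strict gap after the push.
    have hlt {t : ℝ} (ht : 0 < t) : R.hi (v + t • u) < R.lo (v + t • u) := by
      have h2 := hhi v (t • u)
      have h3 := hlo v (t • u)
      rw [R.hi_smul _ _ ht, h1] at h2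
      rw [R.lo_smul _ _ ht, hve.1] at h3
      have := mul_lt_mul_of_pos_left hu ht
      linarith
    rw [mem_nhdsWithin_iff_eventually, ← hp0] at hn
    have hev := (hp.eventually hn).and hpos
    obtain ⟨t, ⟨h2, h3⟩, ht⟩ := ((hev.filter_mono nhdsWithin_le_nhds).and
      (self_mem_nhdsWithin : ∀ᶠ t : ℝ in nhdsWithin 0 (Set.Ioi 0), t ∈ Set.Ioi 0)).exists
    have hlop : 1 < R.lo (p t) := by
      rw [R.lo_smul _ _ (inv_pos.2 h3), ← div_eq_inv_mul, one_lt_div h3]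
      exact hlt ht
    have hhip : R.hi (p t) = 1 := by
      rw [R.hi_smul _ _ (inv_pos.2 h3), inv_mul_cancel₀ h3.ne']
    exact hlop.ne' (h2 (Or.inr ⟨hlop.le, hhip⟩)).1
  · rintro ⟨h1, h2⟩
    refine ⟨Or.inl ⟨h1, h2.le⟩, ?_⟩
    rw [mem_nhdsWithin_iff_eventually]
    filter_upwards [R.continuous_hi.continuousAt.eventually_lt_const h2] with w hw hwm
    exact hwm.resolve_right fun h => hw.ne h.2

/-- The rim, where `lo = hi = 1`, belongs to both parts of the frontier; it is kept because it is
not in the relative interior of `entry`. -/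
theorem frontier_diff_interiorIn_entry (hlo : ∀ v w, R.lo v + R.lo w ≤ R.lo (v + w))
    (hhi : ∀ v w, R.hi (v + w) ≤ R.hi v + R.hi w) {u : V} (hu : R.hi u < R.lo u) :
    frontier R.cone \ interiorIn (frontier R.cone) R.entry = R.exit := by
  rw [frontier_cone, interiorIn_entry hlo hhi hu]
  ext v
  constructor
  · rintro ⟨h | h, hn⟩
    · exact ⟨h.1.ge, le_antisymm h.2 (not_lt.1 fun h' => hn ⟨h.1, h'⟩)⟩
    · exact h
  · exact fun h => ⟨Or.inr h, fun hn => hn.2.ne h.2⟩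

theorem mem_interior_body {w : V}
    (h : 1 < R.lo w ∧ 1 < R.top w ∧ R.lo w < R.top w + ε) : w ∈ interior (R.body ε) := by
  have key {v : V} (hv : 1 < R.lo v) : (1 < R.top v ↔ R.hi v < R.lo v) ∧
      (R.lo v < R.top v + ε ↔ (R.lo v - ε) * R.hi v < R.lo v) := by
    have := R.hi_pos v (one_pos.trans hv)
    exact ⟨one_lt_div this, by rw [← sub_lt_iff_lt_add, top, lt_div_iff₀ this]⟩
  -- Clearing the denominator of `top` leaves strict inequalities between functions that are
  -- continuous on all of `V`, hence an open set.
  refine mem_interior.2 ⟨{v | 1 < R.lo v ∧ R.hi v < R.lo v ∧ (R.lo v - ε) * R.hi v < R.lo v},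
    ?_, ?_, h.1, (key h.1).1.1 h.2.1, (key h.1).2.1 h.2.2⟩
  · rintro v ⟨h1, h2, h3⟩
    exact ⟨h1.le, ((key h1).1.2 h2).le, ((key h1).2.2 h3).le⟩
  · exact (isOpen_lt continuous_const R.continuous_lo).inter
      ((isOpen_lt R.continuous_hi R.continuous_lo).inter
        (isOpen_lt ((R.continuous_lo.sub continuous_const).mul R.continuous_hi) R.continuous_lo))

/-- The deformation along the rays, carried over to the union of the truncated cone
and of the cylinder over its entry part. -/
theorem exists_homotopy {X : Type*} [TopologicalSpace X] {ι : V → X}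
    (hι : Topology.IsEmbedding ι) {d : ℕ} (L : V ≃ₜ EuclideanSpace ℝ (Fin d)) (hε : 0 < ε)
    {E : Set (X × ℝ)}
    (hE : E = (ι '' R.cone) ×ˢ {0} ∪ (ι '' R.entry) ×ˢ Set.Icc 0 ε)
    {B U T : Set E}
    (hB : B = {z | z.1 ∈ (ι '' R.cone) ×ˢ ({0} : Set ℝ)})
    (hU : U = {z | z.1 ∈ (ι '' R.exit) ×ˢ ({0} : Set ℝ)})
    (hT : T = {z | z.1 ∈ (ι '' R.entry) ×ˢ Set.Icc (0 : ℝ) ε}) :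
    ∃ (f : C(E, E)) (H : ContinuousMap.Homotopy (ContinuousMap.id E) f),
      ((∀ t : unitInterval, ∀ x ∈ B, H (t, x) ∈ B) ∧
        (fun x => H (1, x)) '' B = U ∧
        (∀ t : unitInterval, ∀ x ∈ U, H (t, x) = x)) ∧
      (∃ e : T ≃ₜ E, ∀ x : T, e x = H (1, (x : E))) ∧
      (∀ t : unitInterval, ∀ x ∈ manifoldBoundary d E, H (t, x) = x) := by
  have hemb : Topology.IsEmbedding (Prod.map ι id ∘ R.fold ε) :=
    (hι.prodMap Topology.IsEmbedding.id).comp isEmbedding_fold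
  have hrange : Set.range (Prod.map ι id ∘ R.fold ε) = E := by
    rw [Set.range_comp, range_fold hε, Set.image_union, hE, Set.prodMap_image_prod,
      Set.prodMap_image_prod, Set.image_id, Set.image_id]
  let Φ : R.body ε ≃ₜ E := hemb.toHomeomorph.trans (Homeomorph.setCongr hrange)
  have hΦ (w : R.body ε) (S : Set V) (J : Set ℝ) :
      (Φ w).1 ∈ (ι '' S) ×ˢ J ↔ R.fold ε w ∈ S ×ˢ J := by
    change (ι (R.fold ε w).1, (R.fold ε w).2) ∈ (ι '' S) ×ˢ J ↔ _
    rw [Set.mem_prod, Set.mem_prod, hι.injective.mem_set_image]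
  have hBm (w : R.body ε) : Φ w ∈ B ↔ 1 + ε ≤ R.lo w := by
    rw [hB, ← fold_mem_cone_iff]; exact hΦ w _ _
  have hUm (w : R.body ε) : Φ w ∈ U ↔ R.lo w = R.top w + ε := by
    rw [hU, ← fold_mem_exit_iff]; exact hΦ w _ _
  have hTm (w : R.body ε) : Φ w ∈ T ↔ R.lo w ≤ 1 + ε := by
    rw [hT, ← fold_mem_entry_iff]; exact hΦ w _ _
  let h : unitInterval × E → E := fun p => Φ (R.deform hε p.1 (Φ.symm p.2))
  have hh (t : unitInterval) (w : R.body ε) : h (t, Φ w) = Φ (R.deform hε t w) := by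
    simp only [h, Homeomorph.symm_apply_apply]
  have hcont : Continuous h := Φ.continuous.comp ((continuous_deform hε).comp
    (continuous_fst.prodMk (Φ.symm.continuous.comp continuous_snd)))
  refine ⟨⟨fun x => h (1, x), hcont.comp (by fun_prop)⟩,
    { toFun := h, continuous_toFun := hcont, map_zero_left := fun x => ?_,
      map_one_left := fun x => rfl }, ⟨?_, ?_, ?_⟩, ?_, ?_⟩
  · simp only [h, deform_zero, Homeomorph.apply_symm_apply, ContinuousMap.id_apply]
  · intro t x hx
    obtain ⟨w, rfl⟩ := Φ.surjective x
    change h (t, Φ w) ∈ B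
    rw [hh, hBm, lo_deform]
    exact ((hBm w).1 hx).trans (lo_le_level hε t w)
  · change (fun x => h (1, x)) '' B = U
    apply subset_antisymm
    · rintro _ ⟨x, hx, rfl⟩
      obtain ⟨w, rfl⟩ := Φ.surjective x
      simp only [hh]
      rw [hUm, lo_deform, top_deform, level_one, stretch_of_ge hε ((hBm w).1 hx)]
    · intro x hx
      obtain ⟨w, rfl⟩ := Φ.surjective x
      rw [hUm] at hx
      refine ⟨Φ w, (hBm w).2 (by linarith [w.2.2.1]), ?_⟩
      simp only [hh, deform_of_lo_eq_top hε hx]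
  · intro t x hx
    obtain ⟨w, rfl⟩ := Φ.surjective x
    change h (t, Φ w) = Φ w
    rw [hh, deform_of_lo_eq_top hε ((hUm w).1 hx)]
  · refine ⟨{ toFun := fun x => h (1, (x : E))
              invFun := fun x => ⟨Φ (R.undeform hε (Φ.symm x)), (hTm _).2 ?_⟩
              left_inv := ?_
              right_inv := ?_
              continuous_toFun := hcont.comp (by fun_prop)
              continuous_invFun := ?_ }, fun x => rfl⟩
    · rw [lo_undeform]; exact shrink_le hε _
    · rintro ⟨x, hx⟩
      obtain ⟨w, rfl⟩ := Φ.surjective x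
      simp only [hh, Homeomorph.symm_apply_apply, undeform_deform hε ((hTm w).1 hx)]
    · intro x
      simp only [hh, deform_undeform, Homeomorph.apply_symm_apply]
    · exact (Φ.continuous.comp ((continuous_undeform hε).comp Φ.symm.continuous)).subtype_mk _
  · intro t x hx
    obtain ⟨w, rfl⟩ := Φ.surjective x
    change h (t, Φ w) = Φ w
    rw [hh]
    -- A moved point is interior to the lengthened cone; its chart, carried over by `Φ` and `L`,
    -- contradicts membership in the manifold boundary.
    by_contra hne
    obtain ⟨e, he⟩ := exists_openPartialHomeomorph_of_mem_interior
      (mem_interior_body (mem_of_deform_ne hε fun hd => hne (congrArg Φ hd)))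
    refine hx ⟨(Φ.symm.toOpenPartialHomeomorph.trans e).trans L.toOpenPartialHomeomorph, ?_⟩
    simpa using he

end RadialPair

/-! ### The affine span of the permutohedron. -/

theorem sum_permVertex {n : ℕ} (σ : Equiv.Perm (Fin n)) :
    ∑ i, permVertex σ i = ∑ i : Fin n, ((i : ℕ) + 1 : ℝ) :=
  Equiv.sum_comp σ⁻¹ fun i : Fin n => ((i : ℕ) + 1 : ℝ)

theorem sum_eq_of_mem_permutohedron {n : ℕ} {x : Fin n → ℝ} (hx : x ∈ permutohedron n) :
    ∑ i, x i = ∑ i : Fin n, ((i : ℕ) + 1 : ℝ) := by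
  let l : (Fin n → ℝ) →ₗ[ℝ] ℝ := ∑ i, LinearMap.proj i
  have hl (y : Fin n → ℝ) : l y = ∑ i, y i := by simp [l]
  have hc : Convex ℝ {y : Fin n → ℝ | ∑ i, y i = ∑ i : Fin n, ((i : ℕ) + 1 : ℝ)} := by
    simp only [← hl]
    exact convex_hyperplane l.isLinear _
  exact convexHull_min (by rintro _ ⟨σ, rfl⟩; exact sum_permVertex σ) hc hx

/-- The vertices of the identity and of the transposition of `i` and `j` differ by `i - j` times
this vector. -/
theorem single_sub_single_mem_vectorSpan {n : ℕ} (i j : Fin n) :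
    (Pi.single i 1 - Pi.single j 1 : Fin n → ℝ) ∈
      vectorSpan ℝ (Set.range (permVertex (n := n))) := by
  by_cases hij : i = j
  · simp [hij]
  have h := vsub_mem_vectorSpan ℝ (Set.mem_range_self (f := permVertex (n := n)) 1)
    (Set.mem_range_self (f := permVertex (n := n)) (Equiv.swap i j))
  have hne : ((i : ℕ) : ℝ) - ((j : ℕ) : ℝ) ≠ 0 := by
    rw [sub_ne_zero]
    exact fun h => hij (Fin.ext (Nat.cast_injective h))
  have heq : permVertex (1 : Equiv.Perm (Fin n)) -ᵥ permVertex (Equiv.swap i j) =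
      (((i : ℕ) : ℝ) - ((j : ℕ) : ℝ)) • (Pi.single i 1 - Pi.single j 1 : Fin n → ℝ) := by
    funext l
    simp only [vsub_eq_sub, Pi.sub_apply, permVertex, Pi.smul_apply, smul_eq_mul,
      Equiv.swap_inv, inv_one, Equiv.Perm.one_apply]
    by_cases hi : l = i
    · subst hi
      simp [Pi.single_eq_of_ne hij]
    · by_cases hj : l = j
      · subst hj
        simp [Pi.single_eq_of_ne hi]
      · simp [Equiv.swap_apply_of_ne_of_ne hi hj, Pi.single_eq_of_ne hi, Pi.single_eq_of_ne hj]
  rw [heq] at h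
  simpa [smul_smul, inv_mul_cancel₀ hne] using
    Submodule.smul_mem _ (((i : ℕ) : ℝ) - ((j : ℕ) : ℝ))⁻¹ h

theorem mem_direction_of_sum_eq_zero {n : ℕ} {w : Fin n → ℝ} (hw : ∑ i, w i = 0) :
    w ∈ (affineSpan ℝ (permutohedron n)).direction := by
  rw [permutohedron, affineSpan_convexHull, direction_affineSpan]
  rcases isEmpty_or_nonempty (Fin n) with he | ⟨⟨j⟩⟩
  · rw [Subsingleton.elim w 0]
    exact zero_mem _
  -- The multiples of the `j`-th basis vector cancel, as the coordinates of `w` sum to zero.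
  have : w = ∑ i, w i • (Pi.single i 1 - Pi.single j 1 : Fin n → ℝ) := by
    simp_rw [smul_sub]
    rw [Finset.sum_sub_distrib, ← Finset.sum_smul, hw, zero_smul, sub_zero]
    exact pi_eq_sum_univ' w
  rw [this]
  exact Submodule.sum_mem _ fun i _ =>
    Submodule.smul_mem _ _ (single_sub_single_mem_vectorSpan i j)

/-- The permutohedron has an interior point in the hyperplane that contains it. -/
theorem exists_interior_point_permutohedron (n : ℕ) :
    ∃ q ∈ permutohedron n, ∀ᶠ w in nhds (0 : Fin n → ℝ),
      ∑ i, w i = 0 → q + w ∈ permutohedron n := by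
  have hne : (permutohedron n).Nonempty :=
    ⟨_, subset_convexHull ℝ _ (Set.mem_range_self (1 : Equiv.Perm (Fin n)))⟩
  obtain ⟨q, hq⟩ := hne.intrinsicInterior (convex_convexHull ℝ _)
  have hqm := intrinsicInterior_subset hq
  refine ⟨q, hqm, ?_⟩
  obtain ⟨y, hy, rfl⟩ := mem_intrinsicInterior.1 hq
  have hn := preimage_coe_mem_nhds_subtype.1 (mem_interior_iff_mem_nhds.1 hy)
  rw [mem_nhdsWithin_iff_eventually] at hn
  have ht : Filter.Tendsto (fun w : Fin n → ℝ => (y : Fin n → ℝ) + w) (nhds 0) (nhds y) := by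
    have : Continuous fun w : Fin n → ℝ => (y : Fin n → ℝ) + w := by fun_prop
    simpa using this.tendsto 0
  filter_upwards [ht.eventually hn] with w hw hsum
  refine hw ?_
  rw [add_comm]
  exact AffineSubspace.vadd_mem_of_mem_direction (mem_direction_of_sum_eq_zero hsum) y.2

theorem isClosed_permutohedron (n : ℕ) : IsClosed (permutohedron n) :=
  (Set.finite_range _).isClosed_convexHull ℝ

theorem convex_permutohedron (n : ℕ) : Convex ℝ (permutohedron n) := convex_convexHull ℝ _

/-! ### The cell as a truncated cone seen from outside. -/

section

variable {k : ℕ} (m : Fin k → ℕ)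

/-- The sums of the coordinates in the factors of `CellSpace m`. -/
def coordSums : CellSpace m →ₗ[ℝ] (Fin k → ℝ) × ℝ where
  toFun v := (fun i => ∑ j, v.1 i j, ∑ j, v.2 j)
  map_add' v w := by
    refine Prod.ext (funext fun i => ?_) ?_ <;> simp [Finset.sum_add_distrib]
  map_smul' c v := by
    refine Prod.ext (funext fun i => ?_) ?_ <;> simp [Finset.mul_sum]

/-- The direction of the affine span of the cell. -/
abbrev CellDir : Submodule ℝ (CellSpace m) := LinearMap.ker (coordSums m)

variable {m}

theorem mem_cellDir {v : CellSpace m} :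
    v ∈ CellDir m ↔ (∀ i, ∑ j, v.1 i j = 0) ∧ ∑ j, v.2 j = 0 := by
  rw [LinearMap.mem_ker, Prod.ext_iff, funext_iff]
  rfl

theorem finrank_cellDir (hm : ∀ i, 1 ≤ m i) : Module.finrank ℝ (CellDir m) = ∑ i, m i := by
  have hsurj : Function.Surjective (coordSums m) := by
    rintro ⟨a, b⟩
    refine ⟨(fun i => Pi.single ⟨0, hm i⟩ (a i), Pi.single 0 b), ?_⟩
    refine Prod.ext (funext fun i => ?_) ?_ <;> simp [coordSums]
  have h := (coordSums m).finrank_range_add_finrank_ker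
  rw [LinearMap.range_eq_top.2 hsurj, finrank_top] at h
  simp only [Module.finrank_prod, Module.finrank_pi, Module.finrank_pi_fintype, Fintype.card_fin,
    Module.finrank_self] at h
  change Module.finrank ℝ (LinearMap.ker (coordSums m)) = _
  omega

/-- A point of `ℝ^{k+1}` from which exactly the facets of the simplex are visible that are opposite
to neither the first nor the last vertex. -/
noncomputable def viewPoint (k : ℕ) : Fin (k + 1) → ℝ :=
  fun i => -1 + (Pi.single 0 (k / 2 + 1 : ℝ) : Fin (k + 1) → ℝ) i +
    (Pi.single (Fin.last k) (k / 2 + 1 : ℝ) : Fin (k + 1) → ℝ) i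

/-- The two added terms `k / 2 + 1` compensate for the `k + 1` entries -1, which places the point in
the hyperplane of the simplex. -/
theorem sum_viewPoint (k : ℕ) : ∑ i, viewPoint k i = 1 := by
  simp only [viewPoint, Finset.sum_add_distrib, Finset.sum_pi_single', Finset.sum_const,
    Finset.card_univ, Fintype.card_fin, Finset.mem_univ, if_true]
  simp
  ring

theorem viewPoint_zero (hk : 2 ≤ k) : viewPoint k 0 = k / 2 := by
  have : (0 : Fin (k + 1)) ≠ Fin.last k := by
    rw [Ne, Fin.ext_iff]; simp; omega
  simp [viewPoint, Pi.single_eq_of_ne this]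

theorem viewPoint_last (hk : 2 ≤ k) : viewPoint k (Fin.last k) = k / 2 := by
  have : Fin.last k ≠ 0 := by
    rw [Ne, Fin.ext_iff]; simp; omega
  simp [viewPoint, Pi.single_eq_of_ne this]

theorem viewPoint_of_ne {i : Fin (k + 1)} (h0 : i ≠ 0) (hl : i ≠ Fin.last k) :
    viewPoint k i = -1 := by
  simp [viewPoint, Pi.single_eq_of_ne h0, Pi.single_eq_of_ne hl]

/-- The vertices of the simplex other than the first and the last one. -/
def middle (k : ℕ) : Finset (Fin (k + 1)) := Finset.univ.filter fun i => i ≠ 0 ∧ i ≠ Fin.last k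

theorem mem_middle {i : Fin (k + 1)} : i ∈ middle k ↔ i ≠ 0 ∧ i ≠ Fin.last k := by
  simp [middle]

theorem middle_nonempty (hk : 2 ≤ k) : (middle k).Nonempty :=
  ⟨⟨1, by omega⟩, mem_middle.2 ⟨by simp [Fin.ext_iff], by simp [Fin.ext_iff]; omega⟩⟩

variable (m) in
/-- The affine isometry of `CellDir m` onto the affine span of the cell, based above the
product point `q` at the point `viewPoint k`. -/
noncomputable def cellChart (q : (i : Fin k) → (Fin (m i) → ℝ)) :
    CellDir m →ᵃⁱ[ℝ] CellSpace m :=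
  (AffineIsometryEquiv.constVAdd ℝ (CellSpace m) (q, viewPoint k)).toAffineIsometry.comp
    (CellDir m).subtypeₗᵢ.toAffineIsometry

variable {q : (i : Fin k) → (Fin (m i) → ℝ)}

theorem cellChart_snd (v : CellDir m) (i : Fin (k + 1)) :
    (cellChart m q v).2 i = viewPoint k i + v.1.2 i := rfl

theorem sum_cellChart_snd (v : CellDir m) : ∑ i, (cellChart m q v).2 i = 1 := by
  simp only [cellChart_snd, Finset.sum_add_distrib, sum_viewPoint, (mem_cellDir.1 v.2).2, add_zero]

theorem mem_range_cellChart (hq : q ∈ permProduct m) {x : CellSpace m}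
    (h1 : x.1 ∈ permProduct m) (h2 : ∑ i, x.2 i = 1) : x ∈ Set.range (cellChart m q) := by
  refine ⟨⟨x - (q, viewPoint k), mem_cellDir.2 ⟨fun i => ?_, ?_⟩⟩, add_sub_cancel _ _⟩
  · have hx := sum_eq_of_mem_permutohedron (h1 i trivial)
    have hq := sum_eq_of_mem_permutohedron (hq i trivial)
    simp [Finset.sum_sub_distrib, hx, hq]
  · simp [Finset.sum_sub_distrib, h2, sum_viewPoint]

variable (m) in
/-- The polyhedron cut out by the facets of the cell that are not visible from `viewPoint`. -/
def hiddenHull : Set (CellSpace m) :=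
  permProduct m ×ˢ {x | 0 ≤ x 0 ∧ 0 ≤ x (Fin.last k)}

theorem convex_hiddenHull : Convex ℝ (hiddenHull m) := by
  refine Convex.prod (convex_pi fun i _ => convex_permutohedron _) (Convex.inter ?_ ?_)
  · exact convex_halfSpace_ge (LinearMap.proj (R := ℝ) (0 : Fin (k + 1))).isLinear 0
  · exact convex_halfSpace_ge (LinearMap.proj (R := ℝ) (Fin.last k)).isLinear 0

theorem isClosed_hiddenHull : IsClosed (hiddenHull m) := by
  refine IsClosed.prod (isClosed_set_pi fun i _ => isClosed_permutohedron _) (IsClosed.inter ?_ ?_)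
  · exact isClosed_le continuous_const (continuous_apply _)
  · exact isClosed_le continuous_const (continuous_apply _)

variable (m q) in
/-- The preimage of `hiddenHull m` in `CellDir m`. -/
def hiddenSet : Set (CellDir m) := cellChart m q ⁻¹' hiddenHull m

theorem convex_hiddenSet : Convex ℝ (hiddenSet m q) :=
  convex_hiddenHull.affine_preimage (cellChart m q).toAffineMap

theorem isClosed_hiddenSet : IsClosed (hiddenSet m q) :=
  isClosed_hiddenHull.preimage (cellChart m q).continuous

/-- The view point lies strictly on the inner side of all hidden facets: each `q i` is a relative
interior point, and both end coordinates equal `k / 2 > 0`. -/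
theorem hiddenSet_mem_nhds (hk : 2 ≤ k)
    (hq : ∀ i, ∀ᶠ w in nhds (0 : Fin (m i) → ℝ), ∑ j, w j = 0 → q i + w ∈ permutohedron (m i)) :
    hiddenSet m q ∈ nhds 0 := by
  have hk' : (0 : ℝ) < k / 2 := by
    have : (0 : ℝ) < k := by exact_mod_cast (by omega : 0 < k)
    positivity
  have h1 : ∀ᶠ v : CellDir m in nhds 0, ∀ i, q i + v.1.1 i ∈ permutohedron (m i) := by
    refine Filter.eventually_all.2 fun i => ?_
    have hc : Continuous fun v : CellDir m => v.1.1 i := by fun_prop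
    have ht : Filter.Tendsto (fun v : CellDir m => v.1.1 i) (nhds 0) (nhds 0) := hc.tendsto 0
    filter_upwards [ht.eventually (hq i)] with v hv
    exact hv ((mem_cellDir.1 v.2).1 i)
  have h2 (j : Fin (k + 1)) (hj : viewPoint k j = k / 2) :
      ∀ᶠ v : CellDir m in nhds 0, 0 < viewPoint k j + v.1.2 j := by
    have hc : Continuous fun v : CellDir m => viewPoint k j + v.1.2 j := by fun_prop
    exact hc.continuousAt.eventually_const_lt (by simpa [hj] using hk')
  filter_upwards [h1, h2 0 (viewPoint_zero hk), h2 _ (viewPoint_last hk)] with v hv hv0 hvl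
  exact ⟨fun i _ => hv i, hv0.le, hvl.le⟩

theorem gauge_hiddenSet_le_one_iff (hn : hiddenSet m q ∈ nhds 0) (v : CellDir m) :
    gauge (hiddenSet m q) v ≤ 1 ↔ v ∈ hiddenSet m q := by
  rw [gauge_le_one_iff_mem_closure convex_hiddenSet hn, isClosed_hiddenSet.closure_eq]

/-- The smallest of the coordinates of a direction that are visible from `viewPoint`. -/
noncomputable def minMiddle (hk : 2 ≤ k) (v : CellDir m) : ℝ :=
  (middle k).inf' (middle_nonempty hk) fun i => v.1.2 i

theorem le_minMiddle_iff {hk : 2 ≤ k} {v : CellDir m} {a : ℝ} :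
    a ≤ minMiddle hk v ↔ ∀ i ∈ middle k, a ≤ v.1.2 i :=
  Finset.le_inf'_iff _ _

theorem exists_minMiddle_eq (hk : 2 ≤ k) (v : CellDir m) :
    ∃ i ∈ middle k, minMiddle hk v = v.1.2 i :=
  Finset.exists_mem_eq_inf' _ _

theorem minMiddle_add_le (hk : 2 ≤ k) (v w : CellDir m) :
    minMiddle hk v + minMiddle hk w ≤ minMiddle hk (v + w) :=
  le_minMiddle_iff.2 fun i hi =>
    add_le_add (le_minMiddle_iff.1 le_rfl i hi) (le_minMiddle_iff.1 le_rfl i hi)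

theorem minMiddle_smul (hk : 2 ≤ k) (t : ℝ) (v : CellDir m) (ht : 0 < t) :
    minMiddle hk (t • v) = t * minMiddle hk v := by
  apply le_antisymm
  · obtain ⟨i, hi, h⟩ := exists_minMiddle_eq hk v
    rw [h]
    exact le_minMiddle_iff.1 le_rfl i hi
  · exact le_minMiddle_iff.2 fun i hi =>
      mul_le_mul_of_nonneg_left (le_minMiddle_iff.1 le_rfl i hi) ht.le

theorem nonneg_of_forall_add_mul_nonneg {a b : ℝ} (h : ∀ t : ℝ, 0 < t → 0 ≤ a + t * b) :
    0 ≤ b := by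
  by_contra hb
  have hb := not_le.1 hb
  have h1 := h ((|a| + 1) / -b) (div_pos (by positivity) (by linarith))
  have h2 : (|a| + 1) / -b * b = -(|a| + 1) := by
    rw [div_neg, neg_mul, div_mul_cancel₀ _ hb.ne]
  have := le_abs_self a
  linarith

/-- If the gauge vanished, the whole ray would lie in `hiddenSet`, forcing both end coordinates of
`v` to be nonnegative. With positive middle coordinates the sum would then be positive, but it is
zero on `CellDir m`. -/
theorem gauge_hiddenSet_pos (hk : 2 ≤ k) (hn : hiddenSet m q ∈ nhds 0) (v : CellDir m)
    (hv : 0 < minMiddle hk v) : 0 < gauge (hiddenSet m q) v := by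
  refine lt_of_le_of_ne (gauge_nonneg _) fun h0 => ?_
  have hmem (t : ℝ) (ht : 0 < t) : t • v ∈ hiddenSet m q := by
    rw [← gauge_hiddenSet_le_one_iff hn, gauge_smul_of_nonneg ht.le, ← h0]
    simp
  have hv0 : 0 ≤ v.1.2 0 := nonneg_of_forall_add_mul_nonneg fun t ht => (hmem t ht).2.1
  have hvl : 0 ≤ v.1.2 (Fin.last k) :=
    nonneg_of_forall_add_mul_nonneg fun t ht => (hmem t ht).2.2
  have hmid {i} (hi : i ∈ middle k) : 0 < v.1.2 i := hv.trans_le (le_minMiddle_iff.1 le_rfl i hi)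
  obtain ⟨j, hj⟩ := middle_nonempty hk
  have hpos : 0 < ∑ i, v.1.2 i := by
    refine Finset.sum_pos' (fun i _ => ?_) ⟨j, Finset.mem_univ _, hmid hj⟩
    by_cases h : i ∈ middle k
    · exact (hmid h).le
    · rw [mem_middle, not_and_or, not_ne_iff, not_ne_iff] at h
      rcases h with rfl | rfl
      · exact hv0
      · exact hvl
  exact hpos.ne' (mem_cellDir.1 v.2).2

/-- The pair of functions on `CellDir m` that cuts out the cell: one for its glued facets and one
for the others. -/
noncomputable def cellPair (hk : 2 ≤ k) (hn : hiddenSet m q ∈ nhds 0) :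
    RadialPair (CellDir m) where
  lo := minMiddle hk
  hi := gauge (hiddenSet m q)
  continuous_lo := Continuous.finset_inf'_apply _ fun i _ => by fun_prop
  continuous_hi := continuous_gauge convex_hiddenSet hn
  lo_smul := minMiddle_smul hk
  hi_smul t v ht := by rw [gauge_smul_of_nonneg ht.le, smul_eq_mul]
  hi_pos := gauge_hiddenSet_pos hk hn

theorem cellChart_snd_middle {i : Fin (k + 1)} (hi : i ∈ middle k) (v : CellDir m) :
    (cellChart m q v).2 i = v.1.2 i - 1 := by
  rw [cellChart_snd, viewPoint_of_ne (mem_middle.1 hi).1 (mem_middle.1 hi).2]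
  ring

theorem cellChart_mem_cell_iff (hk : 2 ≤ k) (hn : hiddenSet m q ∈ nhds 0) (v : CellDir m) :
    cellChart m q v ∈ cell m ↔ v ∈ (cellPair hk hn).cone := by
  change _ ↔ 1 ≤ minMiddle hk v ∧ gauge (hiddenSet m q) v ≤ 1
  rw [gauge_hiddenSet_le_one_iff hn, le_minMiddle_iff]
  constructor
  · rintro ⟨h1, h2, -⟩
    -- The middle coordinates of the origin are -1, so nonnegativity on the simplex reads `1 ≤ v.1.2
    -- i`.
    refine ⟨fun i hi => ?_, h1, h2 _, h2 _⟩
    have := h2 i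
    rw [cellChart_snd_middle hi] at this
    linarith
  · rintro ⟨h1, h2, h3, h4⟩
    refine ⟨h2, fun i => ?_, sum_cellChart_snd v⟩
    by_cases hi : i ∈ middle k
    · rw [cellChart_snd_middle hi]
      linarith [h1 i hi]
    · rw [mem_middle, not_and_or, not_ne_iff, not_ne_iff] at hi
      rcases hi with rfl | rfl
      · exact h3
      · exact h4

theorem mem_gluedPart_iff {x : CellSpace m} :
    x ∈ gluedPart m ↔ x ∈ cell m ∧ ∃ i ∈ middle k, x.2 i = 0 := by
  simp only [gluedPart, cell, simplexFacet, Set.mem_prod, Set.mem_iUnion, mem_middle]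
  constructor
  · rintro ⟨h1, i, hi, h2, h3⟩
    exact ⟨⟨h1, h2⟩, i, hi, h3⟩
  · rintro ⟨⟨h1, h2⟩, i, hi, h3⟩
    exact ⟨h1, i, hi, h2, h3⟩

theorem cellChart_mem_gluedPart_iff (hk : 2 ≤ k) (hn : hiddenSet m q ∈ nhds 0) (v : CellDir m) :
    cellChart m q v ∈ gluedPart m ↔ v ∈ (cellPair hk hn).entry := by
  rw [mem_gluedPart_iff, cellChart_mem_cell_iff hk hn]
  change (1 ≤ minMiddle hk v ∧ _) ∧ _ ↔ minMiddle hk v = 1 ∧ _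
  constructor
  · rintro ⟨⟨h1, h2⟩, i, hi, h3⟩
    rw [cellChart_snd_middle hi] at h3
    have := le_minMiddle_iff.1 (le_refl (minMiddle hk v)) i hi
    exact ⟨by linarith, h2⟩
  · rintro ⟨h1, h2⟩
    obtain ⟨i, hi, h⟩ := exists_minMiddle_eq hk v
    exact ⟨⟨h1.ge, h2⟩, i, hi, by rw [cellChart_snd_middle hi, ← h, h1, sub_self]⟩

theorem cell_eq_image (hk : 2 ≤ k) (hn : hiddenSet m q ∈ nhds 0) (hq : q ∈ permProduct m) :
    cell m = cellChart m q '' (cellPair hk hn).cone := by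
  ext x
  constructor
  · intro hx
    obtain ⟨v, rfl⟩ := mem_range_cellChart hq hx.1 hx.2.2
    exact ⟨v, (cellChart_mem_cell_iff hk hn v).1 hx, rfl⟩
  · rintro ⟨v, hv, rfl⟩
    exact (cellChart_mem_cell_iff hk hn v).2 hv

theorem gluedPart_eq_image (hk : 2 ≤ k) (hn : hiddenSet m q ∈ nhds 0) (hq : q ∈ permProduct m) :
    gluedPart m = cellChart m q '' (cellPair hk hn).entry := by
  ext x
  constructor
  · intro hx
    have hc := (mem_gluedPart_iff.1 hx).1
    obtain ⟨v, rfl⟩ := mem_range_cellChart hq hc.1 hc.2.2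
    exact ⟨v, (cellChart_mem_gluedPart_iff hk hn v).1 hx, rfl⟩
  · rintro ⟨v, hv, rfl⟩
    exact (cellChart_mem_gluedPart_iff hk hn v).2 hv

/-- The witness is `q` paired with the barycentre of the simplex, which lies in the cell and off all
glued facets. It shows that the cone has nonempty interior and gives the direction in which rim
points are pushed. -/
theorem exists_hi_lt_lo (hk : 2 ≤ k) (hn : hiddenSet m q ∈ nhds 0) (hq : q ∈ permProduct m) :
    ∃ u, 0 < (cellPair hk hn).lo u ∧ (cellPair hk hn).hi u < (cellPair hk hn).lo u := by
  have hpos : (0 : ℝ) < 1 / (k + 1) := by positivity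
  obtain ⟨u, hu⟩ := mem_range_cellChart hq (x := (q, fun _ => 1 / ((k : ℝ) + 1))) hq (by
    simp [mul_inv_cancel₀ (by positivity : (k : ℝ) + 1 ≠ 0)])
  have hhi : gauge (hiddenSet m q) u ≤ 1 := by
    rw [gauge_hiddenSet_le_one_iff hn, hiddenSet, Set.mem_preimage, hu]
    exact ⟨hq, hpos.le, hpos.le⟩
  have hlo : 1 < minMiddle hk u := by
    obtain ⟨i, hi, h⟩ := exists_minMiddle_eq hk u
    have hc := cellChart_snd_middle (q := q) hi u
    rw [hu] at hc
    simp only at hc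
    linarith
  exact ⟨u, one_pos.trans hlo, hhi.trans_lt hlo⟩

/-- The affine isometry `cellChart` carries the intrinsic frontier back to `CellDir m`, where the
cone has nonempty interior and the intrinsic frontier is the ordinary one. -/
theorem ungluedPart_eq_image (hk : 2 ≤ k) (hn : hiddenSet m q ∈ nhds 0)
    (hq : q ∈ permProduct m) :
    ungluedPart m = cellChart m q '' (cellPair hk hn).exit := by
  have hemb := (cellChart m q).isometry.isEmbedding
  obtain ⟨u, h0, hu⟩ := exists_hi_lt_lo hk hn hq
  rw [ungluedPart, cellBoundary, gluedPart_eq_image hk hn hq, cell_eq_image hk hn hq,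
    AffineIsometry.intrinsicFrontier_image,
    intrinsicFrontier_eq_frontier (RadialPair.interior_cone_nonempty h0 hu),
    interiorIn_image hemb, ← Set.image_sdiff hemb.injective,
    RadialPair.frontier_diff_interiorIn_entry (minMiddle_add_le hk)
      (gauge_add_le convex_hiddenSet (absorbent_nhds_zero hn)) hu]

end

theorem mainTheorem8 {k : ℕ} (hk : 2 ≤ k) (m : Fin k → ℕ) (hm : ∀ i, 1 ≤ m i)
    (ε : ℝ) (hε : 0 < ε) :
    ∃ (f : C(extCell m ε, extCell m ε))
      (H : ContinuousMap.Homotopy (ContinuousMap.id (extCell m ε)) f),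
      -- `H` deformation retracts the basic cell, inside itself, onto its unglued boundary part
      ((∀ t : unitInterval, ∀ x ∈ basicInExt m ε, H (t, x) ∈ basicInExt m ε) ∧
        (fun x => H (1, x)) '' basicInExt m ε = ungluedInExt m ε ∧
        (∀ t : unitInterval, ∀ x ∈ ungluedInExt m ε, H (t, x) = x)) ∧
      -- the end of `H` maps the tab homeomorphically onto the extended cell
      (∃ e : tabInExt m ε ≃ₜ extCell m ε, ∀ x : tabInExt m ε, e x = H (1, (x : extCell m ε))) ∧
      -- `H` is the identity homotopy on the boundary of the extended cell
      (∀ t : unitInterval, ∀ x ∈ manifoldBoundary (∑ i, m i) (extCell m ε), H (t, x) = x) := by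
  choose q hq hqn using fun i => exists_interior_point_permutohedron (m i)
  have hqp : q ∈ permProduct m := fun i _ => hq i
  have hn := hiddenSet_mem_nhds hk hqn
  have hfin : Module.finrank ℝ (CellDir m) =
      Module.finrank ℝ (EuclideanSpace ℝ (Fin (∑ i, m i))) := by
    rw [finrank_cellDir hm, finrank_euclideanSpace_fin]
  refine RadialPair.exists_homotopy (R := cellPair hk hn) (ι := cellChart m q)
    (cellChart m q).isometry.isEmbedding
    (ContinuousLinearEquiv.ofFinrankEq hfin).toHomeomorph hε ?_ ?_ ?_ ?_
  · rw [← cell_eq_image hk hn hqp, ← gluedPart_eq_image hk hn hqp]; rfl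
  · rw [← cell_eq_image hk hn hqp]; rfl
  · rw [← ungluedPart_eq_image hk hn hqp]; rfl
  · rw [← gluedPart_eq_image hk hn hqp]; rfl
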